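/- **Definitions.** A numerical polynomial is a polynomial $g\in\mathbb{Q}[x]$ with $g(q)\in\mathbb{Z}$ for every $q\in\mathbb{Z}$. Let $g$ be a numerical polynomial with $g(q)\ge 0$ for all sufficiently large $q\in\mathbb{N}=\{0,1,2,\ldots\}$, let $S=\{q\in\mathbb{N}: g(q)\ge 0\}$, and let $e:S\to\mathbb{N}\cup\{-1,\infty\}$. A *two-level polynomial of degree $g$ and depth $e$* is a sequence of polynomials $\{f_q\}_{q\in S}$ in $\mathbb{Q}[n]$, with $f_q$ of degree exactly $g(q)$, such that, writing $f_q(n)=\sum_{r=0}^{\infty}c_r(q)\,n^{g(q)-r}$ with $c_r(q)=0$ for $r>g(q)$, there exist polynomials $\phi_r\in\mathbb{Q}[x]$ $(r\ge 0)$ with $c_r(q)=\phi_r(q)$ for every $q\in S$ and every integer $r\ge 0$ with $r\le e(q)$. (For $q\in\mathbb{N}\setminus S$ one sets $f_q=0$ and $e(q)=-1$.) For $q\in\mathbb{N}$ let $P_q$ be the path with $q$ vertices, and for $k\in\mathbb{N}$ let $P_q^k$ be the Cartesian product of $k$ copies of $P_q$: its vertices are the $k$-tuples of vertices of $P_q$,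 and two tuples are adjacent if and only if they are adjacent in $P_q$ in one coordinate and equal in all other coordinates. For a finite graph $G$, let $\chi_G$ be its chromatic polynomial, the unique polynomial such that $\chi_G(n)$ is, for every $n\in\mathbb{N}$, the number of ways to color the vertices of $G$ with $n$ colors so that adjacent vertices receive different colors. **Theorem.** Fix $k\in\mathbb{N}$. Then the sequence $\{\chi_{P_q^k}(n)\}_{q\in\mathbb{N}}$ is a two-level polynomial of degree $g(q)=q^k$ and depth $e(q)=q$. (For $k=0$, $g$ is the constant polynomial $1$ and $P_q^0$ is a single vertex.) -/

import Mathlib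

open Polynomial

namespace SimpleGraph

/-- Maps to `Fin n` that are constant along the edges of `H` are counted by `n ^ c`, with `c` the
number of connected components of `H`. -/
theorem card_constant_on_edges {V : Type*} [Fintype V] (H : SimpleGraph V) (n : ℕ) :
    Nat.card {f : V → Fin n // ∀ u v, H.Adj u v → f u = f v} =
      n ^ Nat.card H.ConnectedComponent := by
  classical
  have key : ∀ f : V → Fin n, (∀ u v, H.Adj u v → f u = f v) →
      ∀ u v, H.Reachable u v → f u = f v := by
    rintro f hf u v ⟨p⟩
    induction p with
    | nil => rfl
    | cons h _ ih => exact (hf _ _ h).trans ih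
  let e : {f : V → Fin n // ∀ u v, H.Adj u v → f u = f v} ≃ (H.ConnectedComponent → Fin n) :=
    { toFun := fun f => Quot.lift f.1 (fun u v h => key f.1 f.2 u v h)
      invFun := fun F => ⟨fun v => F (H.connectedComponentMk v), fun u v h =>
        congrArg F (ConnectedComponent.sound h.reachable)⟩
      left_inv := fun f => rfl
      right_inv := fun F => by
        funext c
        induction c using Quot.ind
        rfl }
  rw [Nat.card_congr e, Nat.card_fun]
  simp

/-- The number of proper colourings of a finite graph with `n` colours is a polynomial in `n`. -/
theorem exists_chromaticPolynomial {V : Type*} [Fintype V] (G : SimpleGraph V) :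
    ∃ P : ℚ[X], ∀ n : ℕ, P.eval (n : ℚ) = Nat.card (G.Coloring (Fin n)) := by
  classical
  refine ⟨∑ A ∈ G.edgeFinset.powerset, (-1) ^ A.card *
    X ^ Nat.card (fromEdgeSet (A : Set (Sym2 V))).ConnectedComponent, fun n => ?_⟩
  let mono : (V → Fin n) → Sym2 V → Prop := fun f e => (e.map f).IsDiag
  have hcol : Nat.card (G.Coloring (Fin n)) =
      (Finset.univ.filter fun f : V → Fin n => ∀ e ∈ G.edgeFinset, ¬ mono f e).card := by
    rw [← Fintype.card_subtype, ← Nat.card_eq_fintype_card]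
    refine Nat.card_congr
      { toFun := fun C => ⟨C, ?_⟩
        invFun := fun f => Coloring.mk f.1 ?_
        left_inv := fun C => rfl
        right_inv := fun f => rfl }
    · intro e he
      induction e using Sym2.ind with
      | _ u v => simpa [mono] using C.valid (by simpa using he)
    · intro u v h
      simpa [mono] using f.2 s(u, v) (by simpa using h)
  have hA : ∀ A ∈ G.edgeFinset.powerset,
      (n : ℚ) ^ Nat.card (fromEdgeSet (A : Set (Sym2 V))).ConnectedComponent =
        ∑ f : V → Fin n, ∏ e ∈ A, (if mono f e then (1 : ℚ) else 0) := by
    intro A hA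
    rw [← Nat.cast_pow, ← card_constant_on_edges, Nat.card_eq_fintype_card, Fintype.card_subtype]
    have hprod : ∀ f : V → Fin n, ∏ e ∈ A, (if mono f e then (1 : ℚ) else 0) =
        if ∀ e ∈ A, mono f e then 1 else 0 := fun f => by
      rw [Finset.prod_ite_zero, Finset.prod_const_one]
      congr
    rw [Finset.sum_congr rfl fun f _ => hprod f, Finset.sum_boole]
    congr 2
    ext f
    simp only [Finset.mem_filter, Finset.mem_univ, true_and]
    constructor
    · intro h e he
      induction e using Sym2.ind with
      | _ u v =>
        by_cases huv : u = v
        · simp [mono, huv]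
        · simpa [mono] using h u v (by simp [he, huv])
    · intro h u v huv
      have := h s(u, v) (by simpa using ((fromEdgeSet_adj _).1 huv).1)
      simpa [mono] using this
  rw [hcol, eval_finsetSum]
  have hrhs : ((Finset.univ.filter fun f : V → Fin n => ∀ e ∈ G.edgeFinset, ¬ mono f e).card : ℚ) =
      ∑ f : V → Fin n, ∏ e ∈ G.edgeFinset, ((-if mono f e then (1 : ℚ) else 0) + 1) := by
    rw [← Finset.sum_boole]
    refine Finset.sum_congr rfl fun f _ => ?_
    have hprod : ∏ e ∈ G.edgeFinset, (if ¬ mono f e then (1 : ℚ) else 0) =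
        if ∀ e ∈ G.edgeFinset, ¬ mono f e then 1 else 0 := by
      rw [Finset.prod_ite_zero, Finset.prod_const_one]
      congr
    rw [← hprod]
    refine Finset.prod_congr rfl fun e _ => ?_
    by_cases h : mono f e <;> simp [h]
  rw [hrhs]
  simp only [Finset.prod_add_one]
  rw [Finset.sum_comm]
  refine Finset.sum_congr rfl fun A hA' => ?_
  have : (eval (n : ℚ) ((-1) ^ A.card *
    X ^ Nat.card (fromEdgeSet (A : Set (Sym2 V))).ConnectedComponent : ℚ[X])) =
    (-1) ^ A.card * (n : ℚ) ^ Nat.card (fromEdgeSet (A : Set (Sym2 V))).ConnectedComponent := by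
    simp
  rw [this, hA A hA', Finset.mul_sum]
  refine Finset.sum_congr rfl fun f _ => ?_
  rw [Finset.prod_neg]

/-- The chromatic polynomial `χ_G`: the (unique) polynomial whose value at every `n : ℕ` is the
number of proper vertex colourings of the finite graph `G` with `n` colours. -/
noncomputable def chromaticPolynomial {V : Type*} [Fintype V] (G : SimpleGraph V) : ℚ[X] :=
  G.exists_chromaticPolynomial.choose

theorem eval_chromaticPolynomial {V : Type*} [Fintype V] (G : SimpleGraph V) (n : ℕ) :
    G.chromaticPolynomial.eval (n : ℚ) = Nat.card (G.Coloring (Fin n)) :=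
  G.exists_chromaticPolynomial.choose_spec n

/-- The Cartesian product `G^k = G × ⋯ × G` of `k` copies of `G`: two `k`-tuples of vertices are
adjacent when they are adjacent in `G` in one coordinate and equal in all the others. -/
def cartesianPower {V : Type*} (G : SimpleGraph V) (k : ℕ) : SimpleGraph (Fin k → V) where
  Adj x y := ∃ i, G.Adj (x i) (y i) ∧ ∀ j, j ≠ i → x j = y j
  symm := ⟨fun _ _ ⟨i, h, h'⟩ => ⟨i, h.symm, fun j hj => (h' j hj).symm⟩⟩
  loopless := ⟨fun _ ⟨_, h, _⟩ => h.ne rfl⟩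

end SimpleGraph

/-- A numerical polynomial: a rational polynomial taking integer values at all integers. -/
def IsNumericalPolynomial (g : ℚ[X]) : Prop :=
  ∀ q : ℤ, ∃ z : ℤ, g.eval (q : ℚ) = z

/-- The codegree `r` coefficient of `p`: the coefficient of `n ^ (deg p - r)`, and `0` when
`r > deg p`. -/
noncomputable def codegreeCoeff (p : ℚ[X]) (r : ℕ) : ℚ :=
  if r ≤ p.natDegree then p.coeff (p.natDegree - r) else 0

/-- `f` is a two-level polynomial of degree `g` and depth `e`. Here `S = {q : 0 ≤ g q}`; the depth
takes values in `ℕ ∪ {-1, ∞}`, where `-1` is written `⊥` and `∞` is written `⊤`. Outside `S` the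
sequence is extended by `f q = 0` with `e q = -1`. -/
structure IsTwoLevelPolynomial (g : ℚ[X]) (e : ℕ → WithBot ℕ∞) (f : ℕ → ℚ[X]) : Prop where
  numerical : IsNumericalPolynomial g
  eventually_nonneg : ∀ᶠ q : ℕ in Filter.atTop, 0 ≤ g.eval (q : ℚ)
  degree_eq : ∀ q : ℕ, 0 ≤ g.eval (q : ℚ) →
    f q ≠ 0 ∧ ((f q).natDegree : ℚ) = g.eval (q : ℚ)
  coeff_eq : ∃ φ : ℕ → ℚ[X], ∀ q : ℕ, 0 ≤ g.eval (q : ℚ) →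
    ∀ r : ℕ, (r : WithBot ℕ∞) ≤ e q → codegreeCoeff (f q) r = (φ r).eval (q : ℚ)
  outside : ∀ q : ℕ, g.eval (q : ℚ) < 0 → f q = 0 ∧ e q = ⊥

/-!
Whitney's theorem writes `t ^ |V| * χ_G(1 / t)` as the sum of `(-1) ^ |A| * t ^ rank A` over the
edge sets `A` of `G`. Slice a box of the lattice `ℕ ^ k` in one direction and, for a pair of
graphs on unions of consecutive slices, take the alternating sum over the sets of levels at which
both graphs are cut. Only the pairs of edge sets `(A, B)` which together cross all `m` levels
survive, and these have `rank A + rank B ≥ m`. Once at least one level is cut, the pair consisting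
of slices `0, …, m` and `1, …, m - 1` splits into the same pieces as the pair `0, …, m - 1` and
`1, …, m`. Hence, if `U_m` denotes this polynomial for a box of side `m` in the chosen direction,
`U_(m + 1) * U_(m - 1) ≡ U_m ^ 2` modulo `t ^ m`.

Consequently each coefficient of `t ^ j` in the logarithmic derivative of `U_m` is affine in every
side of the box from `j` on, so it is a polynomial along the diagonal. The recursion expressing
the coefficients of a power series through those of its logarithmic derivative carries this over
to the coefficients of the chromatic polynomial.
-/

section Whitney

open Finset SimpleGraph

theorem card_coloring_eq_sum {V : Type*} [Finite V] (G : SimpleGraph V) [Fintype G.edgeSet]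
    (n : ℕ) :
    (Nat.card (G.Coloring (Fin n)) : ℤ) = ∑ A ∈ G.edgeFinset.powerset,
      (-1) ^ #A * (n : ℤ) ^ Nat.card (fromEdgeSet (A : Set (Sym2 V))).ConnectedComponent := by
  classical
  have := Fintype.ofFinite V
  let mono (e : Sym2 V) : Finset (V → Fin n) := {f | (e.map f).IsDiag}
  have card_proper : Nat.card (G.Coloring (Fin n)) = #(G.edgeFinset.inf fun e => (mono e)ᶜ) := by
    rw [← Fintype.card_coe, ← Nat.card_eq_fintype_card]
    let proper : G.Coloring (Fin n) ≃ {f : V → Fin n // ∀ u v, G.Adj u v → f u ≠ f v} :=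
      ⟨fun C => ⟨C, fun _ _ => C.valid⟩, fun f => Coloring.mk f.1 fun {u v} => f.2 u v,
        fun _ => rfl, fun _ => rfl⟩
    refine Nat.card_congr (proper.trans (Equiv.subtypeEquivRight fun f => ?_))
    simp [mono, Finset.mem_inf, Sym2.forall]
  have card_mono (A : Finset (Sym2 V)) :
      #(A.inf mono) = n ^ Nat.card (fromEdgeSet (A : Set (Sym2 V))).ConnectedComponent := by
    rw [← card_constant_on_edges, ← Fintype.card_coe, ← Nat.card_eq_fintype_card]
    refine Nat.card_congr (Equiv.subtypeEquivRight fun f => ?_)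
    simp only [mono, Finset.mem_inf, mem_filter, mem_univ, true_and, Sym2.forall, Sym2.map_mk,
      Sym2.mk_isDiag_iff, fromEdgeSet_adj, mem_coe]
    exact ⟨fun h u v huv => h u v huv.1, fun h u v he => by
      by_cases huv : u = v
      · rw [huv]
      · exact h u v ⟨he, huv⟩⟩
  rw [card_proper, inclusion_exclusion_card_inf_compl]
  exact sum_congr rfl fun A _ => by rw [card_mono, Nat.cast_pow]

variable {V W : Type*} [Fintype V] [Fintype W]

theorem chromaticPolynomial_eq_of_eval {G : SimpleGraph V} {P : ℚ[X]}
    (hP : ∀ n : ℕ, P.eval (n : ℚ) = Nat.card (G.Coloring (Fin n))) : G.chromaticPolynomial = P := by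
  refine eq_of_infinite_eval_eq _ _ ((Set.infinite_range_of_injective
    (Nat.cast_injective (R := ℚ))).mono ?_)
  rintro _ ⟨n, rfl⟩
  exact (G.eval_chromaticPolynomial n).trans (hP n).symm

theorem chromaticPolynomial_congr {G : SimpleGraph V} {H : SimpleGraph W} (e : G ≃g H) :
    G.chromaticPolynomial = H.chromaticPolynomial :=
  chromaticPolynomial_eq_of_eval fun n => by
    rw [eval_chromaticPolynomial, Nat.card_congr (coloringCongr e (Equiv.refl (Fin n)))]

theorem chromaticPolynomial_sum (G : SimpleGraph V) (H : SimpleGraph W) :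
    (G ⊕g H).chromaticPolynomial = G.chromaticPolynomial * H.chromaticPolynomial :=
  chromaticPolynomial_eq_of_eval fun n => by
    rw [eval_mul, eval_chromaticPolynomial, eval_chromaticPolynomial,
      Nat.card_congr Coloring.sumEquiv, Nat.card_prod, Nat.cast_mul]

theorem chromaticPolynomial_eq_sum (G : SimpleGraph V) [Fintype G.edgeSet] :
    G.chromaticPolynomial = ∑ A ∈ G.edgeFinset.powerset,
      (-1) ^ #A * X ^ Nat.card (fromEdgeSet (A : Set (Sym2 V))).ConnectedComponent :=
  chromaticPolynomial_eq_of_eval fun n => by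
    rw [← Int.cast_natCast (Nat.card (G.Coloring (Fin n))), card_coloring_eq_sum]
    simp [eval_finsetSum]

-- The lower end of an edge going up from height `t ∈ T` is never a highest vertex of its component.
theorem card_add_card_connectedComponent_le {α : Type*} [LinearOrder α] (G : SimpleGraph V)
    (h : V → α) (T : Finset α) (hT : ∀ t ∈ T, ∃ u v, G.Adj u v ∧ h u = t ∧ t < h v) :
    #T + Nat.card G.ConnectedComponent ≤ Fintype.card V := by
  classical
  choose lower upper hadj hlower hupper using fun t : T => hT t t.2
  have exists_top (C : G.ConnectedComponent) :
      ∃ v ∈ C.supp, ∀ w ∈ C.supp, h w ≤ h v :=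
    Set.exists_max_image C.supp h (Set.toFinite _) C.nonempty_supp
  choose top htop hmax using exists_top
  have injective : Function.Injective (Sum.elim lower top) := by
    refine Function.Injective.sumElim (fun s t hst => Subtype.ext ?_) (fun C D hCD => ?_) ?_
    · rw [← hlower s, ← hlower t]
      exact congrArg h hst
    · rw [← htop C, ← htop D, hCD]
    · intro t C htC
      have hmem : upper t ∈ C.supp :=
        C.mem_supp_of_adj_mem_supp (htC ▸ htop C) (hadj t)
      have hle := hmax C _ hmem
      rw [← htC, hlower t] at hle
      exact hle.not_gt (hupper t)
  have : Fintype G.ConnectedComponent := Fintype.ofFinite _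
  simpa [Nat.card_eq_fintype_card] using Fintype.card_le_of_injective _ injective

/-- The rank of a set of edges in the graphic matroid of the complete graph on `V`; loops
contribute nothing. -/
noncomputable def graphicRank (A : Set (Sym2 V)) : ℕ :=
  Fintype.card V - Nat.card (fromEdgeSet A).ConnectedComponent

theorem card_connectedComponent_le (G : SimpleGraph V) :
    Nat.card G.ConnectedComponent ≤ Fintype.card V := by
  simpa using card_add_card_connectedComponent_le G (fun _ => 0) ∅ (by simp)

theorem card_connectedComponent_lt_of_adj {G : SimpleGraph V} {u v : V} (huv : G.Adj u v) :
    Nat.card G.ConnectedComponent < Fintype.card V := by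
  classical
  have := card_add_card_connectedComponent_le G (Pi.single v 1) {0} (by
    simpa using ⟨u, v, huv, by simp [huv.ne]⟩)
  rw [card_singleton] at this
  omega

theorem card_connectedComponent_bot :
    Nat.card (⊥ : SimpleGraph V).ConnectedComponent = Fintype.card V := by
  rw [← Nat.card_eq_fintype_card]
  exact (Nat.card_congr (Equiv.ofBijective (⊥ : SimpleGraph V).connectedComponentMk
    ⟨fun _ _ huv => reachable_bot.1 (ConnectedComponent.exact huv), Quot.mk_surjective⟩)).symm

theorem degree_chromaticPolynomial_sub_X_pow_lt (G : SimpleGraph V) :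
    (G.chromaticPolynomial - X ^ Fintype.card V).degree < (Fintype.card V : WithBot ℕ) := by
  classical
  rw [chromaticPolynomial_eq_sum, ← add_sum_erase _ _ (a := ∅) (by simp)]
  simp only [card_empty, pow_zero, one_mul, coe_empty, fromEdgeSet_empty,
    card_connectedComponent_bot, add_sub_cancel_left]
  refine mem_degreeLT.1 (sum_mem fun A hA => mem_degreeLT.2 ?_)
  simp only [mem_erase, mem_powerset] at hA
  obtain ⟨⟨u, v⟩, he⟩ := nonempty_iff_ne_empty.2 hA.1
  have huv : (fromEdgeSet (A : Set (Sym2 V))).Adj u v :=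
    (fromEdgeSet_adj _).2 ⟨he, (G.mem_edgeSet.1 (mem_edgeFinset.1 (hA.2 he))).ne⟩
  rw [← C_1, ← C_neg, ← C_pow]
  exact (degree_C_mul_X_pow_le _ _).trans_lt
    (Nat.cast_lt.2 (card_connectedComponent_lt_of_adj huv))

theorem monic_chromaticPolynomial (G : SimpleGraph V) : G.chromaticPolynomial.Monic := by
  rw [← add_sub_cancel (X ^ Fintype.card V) G.chromaticPolynomial]
  exact monic_X_pow_add (degree_chromaticPolynomial_sub_X_pow_lt G)

theorem natDegree_chromaticPolynomial (G : SimpleGraph V) :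
    G.chromaticPolynomial.natDegree = Fintype.card V := by
  rw [← add_sub_cancel (X ^ Fintype.card V) G.chromaticPolynomial]
  rw [natDegree_add_eq_left_of_degree_lt, natDegree_X_pow]
  simpa using degree_chromaticPolynomial_sub_X_pow_lt G

end Whitney

section CodegreePolynomial

open Finset SimpleGraph

variable {V W : Type*} [Fintype V] [Fintype W]

/-- The polynomial `t ^ |V| * χ_G(1 / t)`, in which the coefficient of `t ^ r` is the coefficient of
codegree `r` of the chromatic polynomial of `G`. -/
noncomputable def codegreePolynomial (G : SimpleGraph V) : ℚ[X] :=
  G.chromaticPolynomial.reverse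

theorem coeff_reverse_eq_codegreeCoeff (p : ℚ[X]) (r : ℕ) :
    p.reverse.coeff r = codegreeCoeff p r := by
  rw [codegreeCoeff, coeff_reverse]
  split_ifs with hr
  · rw [revAt_le hr]
  · rw [revAt_eq_self_of_lt (not_le.1 hr), coeff_eq_zero_of_natDegree_lt (not_le.1 hr)]

theorem coeff_codegreePolynomial (G : SimpleGraph V) (r : ℕ) :
    (codegreePolynomial G).coeff r = codegreeCoeff G.chromaticPolynomial r :=
  coeff_reverse_eq_codegreeCoeff _ r

theorem coeff_zero_codegreePolynomial (G : SimpleGraph V) :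
    (codegreePolynomial G).coeff 0 = 1 := by
  rw [codegreePolynomial, coeff_zero_reverse, monic_chromaticPolynomial]

theorem codegreePolynomial_congr {G : SimpleGraph V} {H : SimpleGraph W} (e : G ≃g H) :
    codegreePolynomial G = codegreePolynomial H := by
  rw [codegreePolynomial, codegreePolynomial, chromaticPolynomial_congr e]

theorem codegreePolynomial_sum (G : SimpleGraph V) (H : SimpleGraph W) :
    codegreePolynomial (G ⊕g H) = codegreePolynomial G * codegreePolynomial H := by
  rw [codegreePolynomial, chromaticPolynomial_sum, reverse_mul_of_domain]
  rfl

theorem codegreePolynomial_eq_sum (G : SimpleGraph V) [Fintype G.edgeSet] :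
    codegreePolynomial G = ∑ A ∈ G.edgeFinset.powerset,
      (-1) ^ #A * X ^ graphicRank (A : Set (Sym2 V)) := by
  let reflectHom : ℚ[X] →+ ℚ[X] :=
    AddMonoidHom.mk' (reflect (Fintype.card V)) fun p q => reflect_add p q _
  have hreverse : codegreePolynomial G = reflectHom G.chromaticPolynomial := by
    rw [codegreePolynomial, reverse, natDegree_chromaticPolynomial]
    rfl
  rw [hreverse, chromaticPolynomial_eq_sum, map_sum]
  refine sum_congr rfl fun A _ => ?_
  rw [← C_1, ← C_neg, ← C_pow]
  refine (reflect_C_mul_X_pow _ _).trans ?_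
  rw [revAt_le (card_connectedComponent_le _), graphicRank]

end CodegreePolynomial

section Cut

open Finset SimpleGraph

variable {V : Type*}

/-- The graph obtained from `G` by deleting all edges between the levels `g` and `g + 1` of the
height function `h`, for every `g ∈ S`. -/
def cut (G : SimpleGraph V) (h : V → ℕ) (S : Finset ℕ) : SimpleGraph V :=
  G.deleteEdges {e | ∃ g ∈ S, e.map h = s(g, g + 1)}

theorem cut_empty (G : SimpleGraph V) (h : V → ℕ) : cut G h ∅ = G := by
  simp [cut]

theorem cut_comap {W : Type*} (G : SimpleGraph V) (h : V → ℕ) (S : Finset ℕ) (f : W → V) :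
    (cut G h S).comap f = cut (G.comap f) (h ∘ f) S := by
  ext u v
  simp [cut]

/-- The levels `g` such that some edge in `A` joins the levels `g` and `g + 1` of `h`. -/
noncomputable def crossedLevels (h : V → ℕ) (A : Finset (Sym2 V)) : Finset ℕ :=
  open Classical in (A.image (Sym2.map h)).preimage (fun g => s(g, g + 1))
    (Function.Injective.injOn fun a b hab => by
      rcases Sym2.eq_iff.1 hab with hab | hab <;> omega)

theorem mem_crossedLevels {h : V → ℕ} {A : Finset (Sym2 V)} {g : ℕ} :
    g ∈ crossedLevels h A ↔ ∃ e ∈ A, e.map h = s(g, g + 1) := by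
  rw [crossedLevels, mem_preimage, mem_image]

theorem card_crossedLevels_le [Fintype V] (h : V → ℕ) (A : Finset (Sym2 V)) :
    #(crossedLevels h A) ≤ graphicRank (A : Set (Sym2 V)) := by
  refine Nat.le_sub_of_add_le (card_add_card_connectedComponent_le _ h _ fun g hg => ?_)
  obtain ⟨⟨u, v⟩, he, hmap⟩ := mem_crossedLevels.1 hg
  rcases Sym2.eq_iff.1 hmap with ⟨hu, hv⟩ | ⟨hu, hv⟩
  · exact ⟨u, v, (fromEdgeSet_adj _).2 ⟨he, by rintro rfl; omega⟩, hu, by omega⟩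
  · exact ⟨v, u, (fromEdgeSet_adj _).2 ⟨Sym2.eq_swap ▸ he, by rintro rfl; omega⟩, hv, by omega⟩

theorem subset_edgeFinset_cut_iff (G : SimpleGraph V) (h : V → ℕ) (S : Finset ℕ)
    [Fintype G.edgeSet] [Fintype (cut G h S).edgeSet] (A : Finset (Sym2 V)) :
    A ⊆ (cut G h S).edgeFinset ↔ A ⊆ G.edgeFinset ∧ Disjoint S (crossedLevels h A) := by
  rw [← coe_subset, ← coe_subset, coe_edgeFinset, coe_edgeFinset, cut, edgeSet_deleteEdges,
    Set.subset_sdiff]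
  refine and_congr_right fun _ => ?_
  simp only [Set.disjoint_left, Finset.disjoint_left, mem_crossedLevels, mem_coe, Set.mem_ofPred_eq]
  grind

theorem codegreePolynomial_cut [Fintype V] (G : SimpleGraph V) (h : V → ℕ) (S : Finset ℕ)
    [Fintype G.edgeSet] :
    codegreePolynomial (cut G h S) = ∑ A ∈ G.edgeFinset.powerset,
      if Disjoint S (crossedLevels h A) then
        (-1) ^ #A * X ^ graphicRank (A : Set (Sym2 V)) else 0 := by
  classical
  rw [codegreePolynomial_eq_sum, ← sum_filter]
  refine sum_congr ?_ fun _ _ => rfl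
  ext A
  simp only [mem_powerset, mem_filter, subset_edgeFinset_cut_iff]

theorem sum_powerset_neg_one_pow_card_of_disjoint {α R : Type*} [DecidableEq α] [CommRing R]
    (U T : Finset α) :
    ∑ S ∈ U.powerset, (if Disjoint S T then (-1 : R) ^ #S else 0) = if U ⊆ T then 1 else 0 := by
  have hfilter : U.powerset.filter (Disjoint · T) = (U \ T).powerset := by
    ext S
    simp [subset_sdiff]
  rw [← sum_filter, hfilter]
  have := congrArg (Int.cast (R := R)) (sum_powerset_neg_one_pow_card (x := U \ T))
  simpa [sdiff_eq_empty_iff_subset, apply_ite] using this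

theorem X_pow_dvd_sum_codegreePolynomial_cut_mul {W : Type*} [Fintype V] [Fintype W]
    (G : SimpleGraph V) (h : V → ℕ) (H : SimpleGraph W) (k : W → ℕ) (m : ℕ) :
    X ^ m ∣ ∑ S ∈ (range m).powerset,
      (-1) ^ #S * (codegreePolynomial (cut G h S) * codegreePolynomial (cut H k S)) := by
  classical
  let a (A : Finset (Sym2 V)) : ℚ[X] := (-1) ^ #A * X ^ graphicRank (A : Set (Sym2 V))
  let b (B : Finset (Sym2 W)) : ℚ[X] := (-1) ^ #B * X ^ graphicRank (B : Set (Sym2 W))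
  -- Summing over `S` first leaves only the pairs `(A, B)` which together cross every level.
  have expand : ∑ S ∈ (range m).powerset,
        (-1) ^ #S * (codegreePolynomial (cut G h S) * codegreePolynomial (cut H k S)) =
      ∑ A ∈ G.edgeFinset.powerset, ∑ B ∈ H.edgeFinset.powerset,
        (if range m ⊆ crossedLevels h A ∪ crossedLevels k B then 1 else 0) * (a A * b B) := by
    simp only [codegreePolynomial_cut]
    simp_rw [sum_mul_sum, mul_sum]
    rw [sum_comm]
    refine sum_congr rfl fun A _ => ?_
    rw [sum_comm]
    refine sum_congr rfl fun B _ => ?_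
    rw [← sum_powerset_neg_one_pow_card_of_disjoint, sum_mul]
    refine sum_congr rfl fun S _ => ?_
    simp only [disjoint_union_right]
    split_ifs <;> simp_all [a, b]
  rw [expand]
  refine dvd_sum fun A _ => dvd_sum fun B _ => ?_
  split_ifs with hcover
  · have hrank : m ≤ graphicRank (A : Set (Sym2 V)) + graphicRank (B : Set (Sym2 W)) := calc
      m = #(range m) := (card_range m).symm
      _ ≤ #(crossedLevels h A) + #(crossedLevels k B) :=
        (card_le_card hcover).trans (card_union_le _ _)
      _ ≤ _ := add_le_add (card_crossedLevels_le h A) (card_crossedLevels_le k B)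
    exact (pow_dvd_pow X hrank).trans ⟨(-1) ^ #A * (-1) ^ #B, by simp only [a, b]; ring⟩
  · simp

end Cut

section Slabs

open Finset SimpleGraph

variable {V : Type*}

/-- The codegree polynomial of the subgraph of `G` induced on the finite set `W`. -/
noncomputable def codegreePolynomialOn (G : SimpleGraph V) (W : Finset V) : ℚ[X] :=
  codegreePolynomial (G.comap ((↑) : W → V))

theorem codegreePolynomialOn_map {V' : Type*} {G : SimpleGraph V} {G' : SimpleGraph V'}
    (f : G ↪g G') (W : Finset V) :
    codegreePolynomialOn G' (W.map f.toEmbedding) = codegreePolynomialOn G W :=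
  (codegreePolynomial_congr ⟨W.equivMap f.toEmbedding, f.map_rel_iff⟩).symm

theorem codegreePolynomialOn_union [DecidableEq V] {G : SimpleGraph V} {W W' : Finset V}
    (hdisj : Disjoint W W') (hadj : ∀ u ∈ W, ∀ v ∈ W', ¬ G.Adj u v) :
    codegreePolynomialOn G (W ∪ W') = codegreePolynomialOn G W * codegreePolynomialOn G W' := by
  refine (codegreePolynomial_congr (Iso.symm ⟨Equiv.Finset.union W W' hdisj, ?_⟩)).trans
    (codegreePolynomial_sum _ _)
  rintro (⟨u, hu⟩ | ⟨u, hu⟩) (⟨v, hv⟩ | ⟨v, hv⟩)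
  · simp
  · simpa using hadj u hu v hv
  · simpa [G.adj_comm] using hadj v hv u hu
  · simp

/-- The vertices of `W` whose height under `h` lies in `[s, t)`. -/
def slab (h : V → ℕ) (W : Finset V) (s t : ℕ) : Finset V :=
  W.filter fun v => h v ∈ Set.Ico s t

theorem mem_slab {h : V → ℕ} {W : Finset V} {s t : ℕ} {v : V} :
    v ∈ slab h W s t ↔ v ∈ W ∧ s ≤ h v ∧ h v < t := by
  simp [slab]

variable {G : SimpleGraph V} {h : V → ℕ}

theorem codegreePolynomialOn_cut_slab (hstep : ∀ u v, G.Adj u v → h v ≤ h u + 1)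
    {S : Finset ℕ} {g : ℕ} (hg : g ∈ S) (W : Finset V) {s t : ℕ} (hs : s ≤ g + 1)
    (ht : g + 1 ≤ t) :
    codegreePolynomialOn (cut G h S) (slab h W s t) =
      codegreePolynomialOn (cut G h S) (slab h W s (g + 1)) *
        codegreePolynomialOn (cut G h S) (slab h W (g + 1) t) := by
  classical
  have hunion : slab h W s t = slab h W s (g + 1) ∪ slab h W (g + 1) t := by
    ext v
    simp only [mem_union, mem_slab]
    grind
  rw [hunion]
  refine codegreePolynomialOn_union ?_ fun u hu v hv huv => ?_
  · rw [Finset.disjoint_left]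
    simp only [mem_slab]
    grind
  · rw [mem_slab] at hu hv
    obtain ⟨hadj, hcut⟩ := deleteEdges_adj.1 huv
    have hle := hstep u v hadj
    have hmap : Sym2.map h s(u, v) = s(g, g + 1) := by
      rw [Sym2.map_mk, show h u = g by omega, show h v = g + 1 by omega]
    exact hcut ⟨g, hg, hmap⟩

theorem X_pow_dvd_codegreePolynomialOn_slab_exchange
    (hstep : ∀ u v, G.Adj u v → h v ≤ h u + 1) (W : Finset V) (m : ℕ) :
    X ^ m ∣ codegreePolynomialOn G (slab h W 0 (m + 1)) * codegreePolynomialOn G (slab h W 1 m) -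
      codegreePolynomialOn G (slab h W 0 m) * codegreePolynomialOn G (slab h W 1 (m + 1)) := by
  let Z (S : Finset ℕ) (s t : ℕ) : ℚ[X] := codegreePolynomialOn (cut G h S) (slab h W s t)
  have altSum_dvd (s t s' t' : ℕ) :
      X ^ m ∣ ∑ S ∈ (range m).powerset, (-1) ^ #S * (Z S s t * Z S s' t') := by
    simp only [Z, codegreePolynomialOn, cut_comap]
    exact X_pow_dvd_sum_codegreePolynomial_cut_mul _ _ _ _ m
  -- A cut at level `g` splits the slabs on both sides into the same four pieces.
  have exchange (S : Finset ℕ) (hS : S ∈ (range m).powerset) (hne : S ≠ ∅) :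
      Z S 0 (m + 1) * Z S 1 m = Z S 0 m * Z S 1 (m + 1) := by
    obtain ⟨g, hg⟩ := nonempty_iff_ne_empty.2 hne
    have hgm : g < m := mem_range.1 (mem_powerset.1 hS hg)
    simp only [Z]
    rw [codegreePolynomialOn_cut_slab hstep hg W (s := 0) (t := m + 1) (by omega) (by omega),
      codegreePolynomialOn_cut_slab hstep hg W (s := 1) (t := m) (by omega) (by omega),
      codegreePolynomialOn_cut_slab hstep hg W (s := 0) (t := m) (by omega) (by omega),
      codegreePolynomialOn_cut_slab hstep hg W (s := 1) (t := m + 1) (by omega) (by omega)]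
    ring
  have hdvd := dvd_sub (altSum_dvd 0 (m + 1) 1 m) (altSum_dvd 0 m 1 (m + 1))
  rw [← sum_sub_distrib, sum_eq_single_of_mem ∅ (empty_mem_powerset _) fun S hS hne => by
    rw [exchange S hS hne, sub_self]] at hdvd
  simpa [Z, cut_empty] using hdvd

end Slabs

section Boxes

open Finset SimpleGraph

variable {k : ℕ}

/-- The nearest-neighbour graph on `ℕ ^ k`. -/
def lattice (k : ℕ) : SimpleGraph (Fin k → ℕ) :=
  (hasse ℕ).cartesianPower k

/-- The lattice points `x` with `0 ≤ x i < b i` for all `i`. -/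
def latticeBox (b : Fin k → ℕ) : Finset (Fin k → ℕ) :=
  Fintype.piFinset fun i => range (b i)

theorem mem_latticeBox {b x : Fin k → ℕ} : x ∈ latticeBox b ↔ ∀ i, x i < b i := by
  simp [latticeBox]

theorem lattice_adj_le {x y : Fin k → ℕ} (hxy : (lattice k).Adj x y) (i : Fin k) :
    y i ≤ x i + 1 := by
  obtain ⟨j, hj, hother⟩ := hxy
  rw [hasse_adj, Nat.covBy_iff_add_one_eq, Nat.covBy_iff_add_one_eq] at hj
  by_cases hij : i = j
  · subst hij
    omega
  · exact (hother i hij).ge.trans (Nat.le_succ _)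

/-- Translation by the vector `a` as an embedding of the lattice into itself. -/
def latticeTranslation (a : Fin k → ℕ) : lattice k ↪g lattice k where
  toEmbedding := addRightEmbedding a
  map_rel_iff' := by
    intro x y
    simp [lattice, cartesianPower, hasse_adj, Nat.covBy_iff_add_one_eq, add_right_comm _ (a _)]

/-- The `k`-th power of the path with `q` vertices is the cube of side `q` in the lattice. -/
def cartesianPowerPathGraphIso (k q : ℕ) :
    (pathGraph q).cartesianPower k ≃g
      (lattice k).comap ((↑) : latticeBox (fun _ : Fin k => q) → Fin k → ℕ) where
  toFun x := ⟨fun i => x i, mem_latticeBox.2 fun i => (x i).2⟩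
  invFun x i := ⟨x.1 i, mem_latticeBox.1 x.2 i⟩
  left_inv _ := rfl
  right_inv _ := rfl
  map_rel_iff' := by
    intro x y
    simp [lattice, cartesianPower, hasse_adj, pathGraph, Fin.ext_iff, Nat.covBy_iff_add_one_eq,
      Fin.covBy_iff]

/-- The codegree polynomial of the box with side lengths `b`. -/
noncomputable def boxPolynomial (b : Fin k → ℕ) : ℚ[X] :=
  codegreePolynomialOn (lattice k) (latticeBox b)

theorem codegreePolynomial_cartesianPower_pathGraph (k q : ℕ) :
    codegreePolynomial ((pathGraph q).cartesianPower k) = boxPolynomial fun _ : Fin k => q :=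
  codegreePolynomial_congr (cartesianPowerPathGraphIso k q)

theorem slab_zero_latticeBox (b : Fin k → ℕ) (i : Fin k) {m n : ℕ} (hmn : m ≤ n) :
    slab (fun x => x i) (latticeBox (Function.update b i n)) 0 m =
      latticeBox (Function.update b i m) := by
  ext x
  simp only [mem_slab, mem_latticeBox]
  grind

theorem slab_one_latticeBox (b : Fin k → ℕ) (i : Fin k) {m n : ℕ} (hmn : m + 1 ≤ n) :
    slab (fun x => x i) (latticeBox (Function.update b i n)) 1 (m + 1) =
      (latticeBox (Function.update b i m)).map
        (latticeTranslation (Pi.single i 1)).toEmbedding := by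
  have translate (y : Fin k → ℕ) (j : Fin k) :
      (latticeTranslation (Pi.single i 1)).toEmbedding y j = y j + if j = i then 1 else 0 := by
    rw [← Pi.single_apply]
    rfl
  ext x
  simp only [mem_slab, mem_latticeBox, mem_map]
  constructor
  · rintro ⟨hx, hpos, hlt⟩
    exact ⟨Function.update x i (x i - 1), by grind, funext fun j => by grind⟩
  · rintro ⟨y, hy, rfl⟩
    grind

theorem X_pow_dvd_boxPolynomial_mul_sub_sq (b : Fin k → ℕ) (i : Fin k) (q : ℕ) :
    X ^ (q + 1) ∣ boxPolynomial (Function.update b i (q + 2)) *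
      boxPolynomial (Function.update b i q) - boxPolynomial (Function.update b i (q + 1)) ^ 2 := by
  have hdvd := X_pow_dvd_codegreePolynomialOn_slab_exchange (fun x y hxy => lattice_adj_le hxy i)
    (latticeBox (Function.update b i (q + 2))) (q + 1)
  rwa [slab_zero_latticeBox b i le_rfl, slab_one_latticeBox b i (Nat.le_succ _),
    slab_zero_latticeBox b i (Nat.le_succ _), slab_one_latticeBox b i le_rfl,
    codegreePolynomialOn_map, codegreePolynomialOn_map, ← sq] at hdvd

end Boxes

section EulerLogDeriv

open Finset

open scoped PowerSeries

variable {R K : Type*} [CommRing R] [Field K]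

variable (R) in
/-- The Euler derivation `X * d/dX`, which multiplies the coefficient of `X ^ n` by `n`. -/
noncomputable def eulerDerivation : Derivation R R⟦X⟧ R⟦X⟧ :=
  (PowerSeries.X : R⟦X⟧) • d⁄dX R

theorem coeff_eulerDerivation (f : R⟦X⟧) (n : ℕ) :
    PowerSeries.coeff n (eulerDerivation R f) = n * PowerSeries.coeff n f := by
  rw [eulerDerivation, Derivation.smul_apply, smul_eq_mul]
  cases n with
  | zero => simp
  | succ n =>
    rw [PowerSeries.coeff_succ_X_mul, PowerSeries.coeff_derivative, Nat.cast_succ, mul_comm]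

theorem X_pow_dvd_eulerDerivation {f : R⟦X⟧} {m : ℕ} (hf : PowerSeries.X ^ m ∣ f) :
    PowerSeries.X ^ m ∣ eulerDerivation R f :=
  PowerSeries.X_pow_dvd_iff.2 fun n hn => by
    rw [coeff_eulerDerivation, PowerSeries.X_pow_dvd_iff.1 hf n hn, mul_zero]

/-- The Euler logarithmic derivative `X * f' / f` of a power series with nonzero constant
coefficient. It turns products into sums, and for constant coefficient `1` its coefficients
determine those of `f`. -/
noncomputable def eulerLogDeriv (f : K⟦X⟧) : K⟦X⟧ :=
  eulerDerivation K f * f⁻¹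

theorem eulerLogDeriv_mul {f g : K⟦X⟧} (hf : PowerSeries.constantCoeff f ≠ 0)
    (hg : PowerSeries.constantCoeff g ≠ 0) :
    eulerLogDeriv (f * g) = eulerLogDeriv f + eulerLogDeriv g := by
  have hf' := PowerSeries.mul_inv_cancel f hf
  have hg' := PowerSeries.mul_inv_cancel g hg
  simp only [eulerLogDeriv, Derivation.leibniz, smul_eq_mul, PowerSeries.mul_inv_rev]
  linear_combination (eulerDerivation K g * g⁻¹) * hf' + (eulerDerivation K f * f⁻¹) * hg'

theorem X_pow_dvd_eulerLogDeriv_sub {f g : K⟦X⟧} (hf : PowerSeries.constantCoeff f ≠ 0)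
    (hg : PowerSeries.constantCoeff g ≠ 0) {m : ℕ} (hfg : PowerSeries.X ^ m ∣ f - g) :
    PowerSeries.X ^ m ∣ eulerLogDeriv f - eulerLogDeriv g := by
  have hf' := PowerSeries.mul_inv_cancel f hf
  have hg' := PowerSeries.mul_inv_cancel g hg
  have hsub : eulerLogDeriv f - eulerLogDeriv g =
      eulerDerivation K (f - g) * f⁻¹ - (f - g) * (eulerDerivation K g * f⁻¹ * g⁻¹) := by
    simp only [eulerLogDeriv, map_sub]
    linear_combination
      (eulerDerivation K g * g⁻¹) * hf' - (eulerDerivation K g * f⁻¹) * hg'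
  rw [hsub]
  exact dvd_sub ((X_pow_dvd_eulerDerivation hfg).mul_right _) (hfg.mul_right _)

theorem natCast_mul_coeff_eq_sum {f : K⟦X⟧} (hf : PowerSeries.constantCoeff f ≠ 0) (n : ℕ) :
    n * PowerSeries.coeff n f =
      ∑ i ∈ range n, PowerSeries.coeff i f * PowerSeries.coeff (n - i) (eulerLogDeriv f) := by
  have hmul : eulerDerivation K f = f * eulerLogDeriv f := by
    rw [eulerLogDeriv, mul_left_comm, PowerSeries.mul_inv_cancel f hf, mul_one]
  have hzero : PowerSeries.coeff 0 (eulerLogDeriv f) = 0 := by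
    rw [eulerLogDeriv, PowerSeries.coeff_zero_eq_constantCoeff_apply, map_mul,
      ← PowerSeries.coeff_zero_eq_constantCoeff_apply, coeff_eulerDerivation, Nat.cast_zero,
      zero_mul, zero_mul]
  rw [← coeff_eulerDerivation, hmul, PowerSeries.coeff_mul,
    Nat.sum_antidiagonal_eq_sum_range_succ fun i j =>
      PowerSeries.coeff i f * PowerSeries.coeff j (eulerLogDeriv f),
    sum_range_succ, Nat.sub_self, hzero, mul_zero, add_zero]

theorem coeff_eulerLogDeriv_add_eq_two_mul {f g h : K⟦X⟧} (hf : PowerSeries.constantCoeff f ≠ 0)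
    (hg : PowerSeries.constantCoeff g ≠ 0) (hh : PowerSeries.constantCoeff h ≠ 0) {m j : ℕ}
    (hdvd : PowerSeries.X ^ m ∣ f * h - g ^ 2) (hj : j < m) :
    PowerSeries.coeff j (eulerLogDeriv f) + PowerSeries.coeff j (eulerLogDeriv h) =
      2 * PowerSeries.coeff j (eulerLogDeriv g) := by
  have hlog := X_pow_dvd_eulerLogDeriv_sub (by simp [hf, hh]) (by simp [hg]) hdvd
  rw [sq, eulerLogDeriv_mul hf hh, eulerLogDeriv_mul hg hg] at hlog
  have hcoeff := PowerSeries.X_pow_dvd_iff.1 hlog j hj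
  rw [map_sub, map_add, map_add] at hcoeff
  linear_combination hcoeff

theorem exists_polynomial_coeff_of_coeff_eulerLogDeriv [CharZero K] {f : ℕ → K⟦X⟧}
    (hf : ∀ q, PowerSeries.constantCoeff (f q) = 1)
    (hlog : ∀ j, ∃ P : K[X], ∀ q, j ≤ q →
      PowerSeries.coeff j (eulerLogDeriv (f q)) = P.eval (q : K)) (r : ℕ) :
    ∃ P : K[X], ∀ q, r ≤ q → PowerSeries.coeff r (f q) = P.eval (q : K) := by
  choose ψ hψ using hlog
  induction r using Nat.strong_induction_on with
  | _ r ih =>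
    choose φ hφ using ih
    obtain rfl | hr := Nat.eq_zero_or_pos r
    · exact ⟨1, fun q _ => by simp [hf]⟩
    refine ⟨C (r : K)⁻¹ * ∑ i : Fin r, φ i i.2 * ψ (r - i), fun q hq => ?_⟩
    rw [eval_C_mul, eq_inv_mul_iff_mul_eq₀ (Nat.cast_ne_zero.2 hr.ne'),
      natCast_mul_coeff_eq_sum (by simp [hf]), eval_finsetSum, ← Fin.sum_univ_eq_sum_range fun i =>
        PowerSeries.coeff i (f q) * PowerSeries.coeff (r - i) (eulerLogDeriv (f q))]
    refine sum_congr rfl fun i _ => ?_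
    rw [eval_mul, hφ i i.2 q (i.2.le.trans hq), hψ (r - i) q ((Nat.sub_le _ _).trans hq)]

end EulerLogDeriv

section SecondDifference

variable {R : Type*} [CommRing R]

theorem eq_add_mul_of_second_difference_eq_zero {f : ℕ → R} {j : ℕ}
    (hf : ∀ q, j ≤ q → f (q + 2) + f q = 2 * f (q + 1)) {q : ℕ} (hq : j ≤ q) :
    f q = f j + (q - j) * (f (j + 1) - f j) := by
  obtain ⟨n, rfl⟩ := Nat.exists_eq_add_of_le hq
  induction n using Nat.twoStepInduction with
  | zero => simp
  | one => simp
  | more n ih₀ ih₁ =>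
    have h₀ := ih₀ (Nat.le_add_right _ _)
    have h₁ := ih₁ (Nat.le_add_right _ _)
    have h₂ := hf (j + n) (Nat.le_add_right _ _)
    simp only [← add_assoc] at h₀ h₁ h₂ ⊢
    push_cast at h₀ h₁ ⊢
    linear_combination h₂ + 2 * h₁ - h₀

theorem exists_polynomial_diagonal_of_second_difference_eq_zero {k : ℕ} {F : (Fin k → ℕ) → R}
    {j : ℕ} (hF : ∀ b i q, j ≤ q → F (Function.update b i (q + 2)) + F (Function.update b i q) =
      2 * F (Function.update b i (q + 1))) :
    ∃ P : R[X], ∀ q, j ≤ q → F (fun _ => q) = P.eval (q : R) := by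
  induction k with
  | zero => exact ⟨C (F Fin.elim0), fun q _ => by simp [Subsingleton.elim _ Fin.elim0]⟩
  | succ k ih =>
    have slice (s : ℕ) : ∃ P : R[X], ∀ q, j ≤ q →
        F (Fin.cons s fun _ => q) = P.eval (q : R) :=
      ih (F := fun b => F (Fin.cons s b)) fun b i q hq => by
        simpa only [Fin.cons_update] using hF (Fin.cons s b) i.succ q hq
    obtain ⟨P₀, hP₀⟩ := slice j
    obtain ⟨P₁, hP₁⟩ := slice (j + 1)
    refine ⟨P₀ + (X - C (j : R)) * (P₁ - P₀), fun q hq => ?_⟩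
    have affine := eq_add_mul_of_second_difference_eq_zero
      (f := fun s => F (Fin.cons s fun _ => q))
      (fun s hs => by simpa only [Fin.update_cons_zero] using hF (Fin.cons 0 fun _ => q) 0 s hs) hq
    have hconst : (Fin.cons q fun _ => q : Fin (k + 1) → ℕ) = fun _ => q := by
      ext i
      cases i using Fin.cases <;> rfl
    rw [← hconst, affine, hP₀ q hq, hP₁ q hq]
    simp

end SecondDifference

section BoxCoefficients

open SimpleGraph

theorem constantCoeff_boxPolynomial {k : ℕ} (b : Fin k → ℕ) :
    PowerSeries.constantCoeff (boxPolynomial b : PowerSeries ℚ) = 1 := by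
  rw [← PowerSeries.coeff_zero_eq_constantCoeff_apply, Polynomial.coeff_coe]
  exact coeff_zero_codegreePolynomial _

/-- The coefficient of `t ^ j` in the Euler logarithmic derivative of the codegree polynomial of the
box with side lengths `b`. -/
noncomputable def boxLogCoeff {k : ℕ} (j : ℕ) (b : Fin k → ℕ) : ℚ :=
  PowerSeries.coeff j (eulerLogDeriv (boxPolynomial b : PowerSeries ℚ))

theorem boxLogCoeff_second_difference_eq_zero {k j : ℕ} (b : Fin k → ℕ) (i : Fin k) {q : ℕ}
    (hq : j ≤ q) :
    boxLogCoeff j (Function.update b i (q + 2)) + boxLogCoeff j (Function.update b i q) =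
      2 * boxLogCoeff j (Function.update b i (q + 1)) := by
  have constantCoeff_ne_zero (b : Fin k → ℕ) :
      PowerSeries.constantCoeff (boxPolynomial b : PowerSeries ℚ) ≠ 0 := by
    rw [constantCoeff_boxPolynomial]
    exact one_ne_zero
  refine coeff_eulerLogDeriv_add_eq_two_mul (constantCoeff_ne_zero _) (constantCoeff_ne_zero _)
    (constantCoeff_ne_zero _) ?_ (Nat.lt_succ_of_le hq)
  simpa using map_dvd coeToPowerSeries.ringHom (X_pow_dvd_boxPolynomial_mul_sub_sq b i q)

theorem exists_polynomial_codegreeCoeff_cartesianPower_pathGraph (k r : ℕ) :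
    ∃ φ : ℚ[X], ∀ q, r ≤ q →
      codegreeCoeff ((pathGraph q).cartesianPower k).chromaticPolynomial r = φ.eval (q : ℚ) := by
  obtain ⟨φ, hφ⟩ := exists_polynomial_coeff_of_coeff_eulerLogDeriv
    (f := fun q => (boxPolynomial fun _ : Fin k => q : PowerSeries ℚ))
    (fun q => constantCoeff_boxPolynomial _)
    (fun j => exists_polynomial_diagonal_of_second_difference_eq_zero (F := boxLogCoeff j)
      fun b i _ => boxLogCoeff_second_difference_eq_zero b i) r
  refine ⟨φ, fun q hq => ?_⟩
  rw [← coeff_codegreePolynomial, codegreePolynomial_cartesianPower_pathGraph, ← hφ q hq,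
    Polynomial.coeff_coe]

end BoxCoefficients

/-- For fixed `k`, the chromatic polynomials of the grid graphs `P_q^k` form a two-level polynomial
of degree `q ^ k` and depth `q`. -/
theorem mainTheorem7 (k : ℕ) :
    IsTwoLevelPolynomial (X ^ k : ℚ[X]) (fun q : ℕ => (q : WithBot ℕ∞))
      (fun q : ℕ => ((SimpleGraph.pathGraph q).cartesianPower k).chromaticPolynomial) := by
  have heval (q : ℕ) : (X ^ k : ℚ[X]).eval (q : ℚ) = (q : ℚ) ^ k := by simp
  have hnonneg (q : ℕ) : 0 ≤ (X ^ k : ℚ[X]).eval (q : ℚ) := by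
    rw [heval]
    positivity
  choose φ hφ using exists_polynomial_codegreeCoeff_cartesianPower_pathGraph k
  exact
    { numerical := fun q => ⟨q ^ k, by simp⟩
      eventually_nonneg := .of_forall hnonneg
      degree_eq := fun q _ => ⟨(monic_chromaticPolynomial _).ne_zero, by
        rw [natDegree_chromaticPolynomial, heval]
        simp⟩
      coeff_eq := ⟨φ, fun q _ r hr => hφ r q (by exact_mod_cast hr)⟩
      outside := fun q hq => absurd hq (hnonneg q).not_gt }
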